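/- Let $G$ be a connected undirected simple graph on $N\ge 2$ nodes $1,\dots,N$, with a weight $w_{ij}=w_{ji}>0$ on each link $\{i,j\}$ (all weights $1$ in the unweighted case). Let $Q$ be its weighted Laplacian: $Q_{ii}$ is the sum of the weights of the links at $i$, $Q_{ij}=-w_{ij}$ if $\{i,j\}$ is a link, and $Q_{ij}=0$ for all other $i\ne j$. Let $\xi=\sum_T\prod_{\{i,j\}\in T}w_{ij}$, the sum being over all spanning trees $T$ of $G$, be the weighted number of spanning trees. Then there are vectors $s_1,\dots,s_N\in\mathbb{R}^{N-1}$ whose Gram matrix is $Q$, that is, $s_i^Ts_j=Q_{ij}$ for all $i,j$. For every such choice of vectors let $\mathcal S$, the simplex of $G$, be their convex hull. There is a unique ellipsoid $\mathcal E_{\mathcal S}$ (with arbitrary centre, and regarded as a hypersurface) of minimal enclosed volume among all nondegenerate ellipsoids in $\mathbb{R}^{N-1}$ that pass through all the points $s_1,\dots,s_N$; it is called the Steiner ellipsoid of $\mathcal S$. The volume $|\mathcal E_{\mathcal S}|$ that it encloses is $$|\mathcal E_{\mathcal S}|=\left(\frac{(N-1)\pi}{N}\right)^{\frac{N-1}{2}}\frac{\sqrt{N\xi}}{\Gamma\left(\frac{N+1}{2}\right)}.$$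 Moreover the volume of the simplex is $|\mathcal S|=\dfrac{N\sqrt{\xi}}{\Gamma(N)}$, so that the ratio of the two volumes depends only on $N$: $$\frac{|\mathcal E_{\mathcal S}|}{|\mathcal S|}=\frac{((N-1)\pi)^{\frac{N-1}{2}}}{N^{\frac{N}{2}}}\,\frac{\Gamma(N)}{\Gamma\left(\frac{N+1}{2}\right)}=\left(\frac{N-1}{N}\right)^{\frac N2}\frac{(2\sqrt\pi)^N}{2\pi}\,\frac{\Gamma\left(\frac N2\right)}{\sqrt{N-1}}.$$ -/

import Mathlib

open MeasureTheory

namespace GraphSimplex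

/-- The weighted Laplacian of the graph `G` with link weights `w`: the diagonal entry at `i` is the
sum of the weights of the links at `i`, the entry at a link `s(i, j)` is minus its weight, all other
entries vanish. Values of `w` outside the links of `G` are ignored. -/
noncomputable def laplacian {V : Type*} [Fintype V]
    (G : SimpleGraph V) (w : Sym2 V → ℝ) : Matrix V V ℝ :=
  open Classical in
  Matrix.of fun i j =>
    if i = j then ∑ k, (if G.Adj i k then w s(i, k) else 0)
    else if G.Adj i j then -w s(i, j) else 0

/-- The weighted number of spanning trees: the sum over all sets `F` of links of `G` for which the
graph on all nodes with link set `F` is a tree, of the product of the link weights over `F`.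
It is the number of spanning trees when all weights are `1`. -/
noncomputable def spanningTreeWeight {V : Type*} [Fintype V] [DecidableEq V]
    (G : SimpleGraph V) (w : Sym2 V → ℝ) : ℝ :=
  open Classical in
  ∑ F : Finset (Sym2 V) with
    (F : Set (Sym2 V)) ⊆ G.edgeSet ∧ (SimpleGraph.fromEdgeSet (F : Set (Sym2 V))).IsTree,
    ∏ e ∈ F, w e

/-- `s` lists the vertex vectors of the simplex of the weighted graph `(G, w)`:
their Gram matrix is the Laplacian. -/
def IsVertexSystem {V : Type*} [Fintype V] {D : ℕ}
    (G : SimpleGraph V) (w : Sym2 V → ℝ) (s : V → EuclideanSpace ℝ (Fin D)) : Prop :=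
  ∀ i j, inner ℝ (s i) (s j) = laplacian G w i j

/-- The simplex with vertices `s`. -/
def simplex {V : Type*} {D : ℕ} (s : V → EuclideanSpace ℝ (Fin D)) :
    Set (EuclideanSpace ℝ (Fin D)) :=
  convexHull ℝ (Set.range s)

/-- A (nondegenerate) ellipsoid, as a hypersurface with arbitrary centre: the image of the unit
sphere under an invertible affine map. -/
def IsEllipsoid {D : ℕ} (X : Set (EuclideanSpace ℝ (Fin D))) : Prop :=
  ∃ f : EuclideanSpace ℝ (Fin D) ≃ᵃ[ℝ] EuclideanSpace ℝ (Fin D),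
    X = f '' Metric.sphere 0 1

/-- The volume enclosed by an ellipsoid `X`: the Lebesgue measure of its convex hull, the solid
ellipsoid bounded by `X`. -/
noncomputable def enclosedVolume {D : ℕ} (X : Set (EuclideanSpace ℝ (Fin D))) : ℝ :=
  volume.real (convexHull ℝ X)

/-- `X` is an ellipsoid that passes through all the vertices `s`. -/
def IsCircumscribedEllipsoid {V : Type*} {D : ℕ} (s : V → EuclideanSpace ℝ (Fin D))
    (X : Set (EuclideanSpace ℝ (Fin D))) : Prop :=
  IsEllipsoid X ∧ ∀ i, s i ∈ X

/-- `X` is a Steiner ellipsoid of the simplex with vertices `s`: a circumscribed ellipsoid of minimal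
volume. -/
def IsSteinerEllipsoid {V : Type*} {D : ℕ} (s : V → EuclideanSpace ℝ (Fin D))
    (X : Set (EuclideanSpace ℝ (Fin D))) : Prop :=
  IsCircumscribedEllipsoid s X ∧
    ∀ Y, IsCircumscribedEllipsoid s Y → enclosedVolume X ≤ enclosedVolume Y

end GraphSimplex

/-!
Both volumes are determinants. Write `N = D + 1`, single out the node `0`, and let `s` be a vertex
system.

*The determinant of the vertices.* The Laplacian is `∑ e, w e • b e (b e)ᵀ` for the columns `b e` of
the oriented incidence matrix, so its reduction at node `0` is positive semidefinite, and a square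
root of it provides a vertex system. By the Cauchy–Binet formula the determinant of the reduction is
a sum of squared `D × D` minors of the incidence matrix. A minor is `±1` if its edges connect all
nodes (paths to node `0` yield an integral inverse), and otherwise `0` (the rows of a component
missing node `0` add up to zero). This is the matrix tree theorem `det_reducedLaplacian`. The Gram
matrix of the vertices other than `s 0` is the reduced Laplacian, so their determinant is `±√ξ`
(`IsVertexSystem.det_vertexMatrix_sq`). Since the vertices sum to zero, the edge vectors issuing from
`s 0` have determinant `±N√ξ`, which is `D!` times the volume of the simplex up to sign.

*The extremal ellipsoid.* If `f` is affine and maps points `u i` of the unit sphere to the `s i`, the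
ellipsoid `f '' sphere` has volume proportional to `|det f|`. Append the constant coordinate
`a = √(1 / D)` to all points. The matrices `U`, `S` of homogeneous coordinates satisfy
`det S = det U * det f`, while `U Uᵀ` has all diagonal entries equal to `1 + a² = N / D`. By the
inequality of the arithmetic and geometric means for its eigenvalues,
`(det U)² ≤ (1 + a²) ^ N`, with equality only if `U Uᵀ = (1 + a²) • 1`. So `|det f|` is bounded below
in terms of `S`, and equality forces the `u i` to form a regular simplex
(`eq_one_of_trace_of_det`). In that case the ellipsoid is the set of points `x` whose coordinate
vector `(a, x) S⁻¹` has norm `1` (`image_sphere_eq_of_normalizedGram_eq_one`), which depends on `s`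
only: this is uniqueness. For existence, a regular simplex is a vertex system of the complete graph
with weights `1 / D`, and a linear map carries it to `s`; comparing determinants gives the volume
(`exists_steinerEllipsoid`).

The second form of the ratio follows from the first by Legendre's duplication formula.
-/

namespace GraphSimplex

open Matrix

/-! ### The Cauchy–Binet formula -/

/-- Expansion of the determinant of a product of rectangular matrices, by multilinearity in the
rows. -/
theorem det_mul_eq_sum_prod_mul_det {n m R : Type*} [Fintype n] [DecidableEq n] [Fintype m]
    [DecidableEq m] [CommRing R] (A : Matrix n m R) (B : Matrix m n R) :
    (A * B).det = ∑ f : n → m, (∏ i, A i (f i)) * (B.submatrix f id).det := by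
  have h : (A * B : Matrix n n R) = fun i => ∑ k, A i k • B k := by
    ext i j
    simp [Matrix.mul_apply, Finset.sum_apply]
  have h2 := (Matrix.detRowAlternating (n := n) (R := R)).toMultilinearMap.map_sum
    (fun i k => A i k • B k)
  rw [h]
  refine h2.trans (Finset.sum_congr rfl fun f _ => ?_)
  exact (Matrix.detRowAlternating (n := n) (R := R)).toMultilinearMap.map_smul_univ
    (fun i => A i (f i)) (fun i => B (f i))

/-- The Cauchy–Binet formula, summed over all column selections `f : n → m` rather than over the
`n`-element subsets of `m`; each subset is then counted `(card n)!` times, and non-injective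
selections contribute `0`. -/
theorem factorial_mul_det_mul {n m R : Type*} [Fintype n] [DecidableEq n] [Fintype m]
    [DecidableEq m] [CommRing R] (A : Matrix n m R) (B : Matrix m n R) :
    ((Fintype.card n).factorial : R) * (A * B).det =
      ∑ f : n → m, (A.submatrix id f).det * (B.submatrix f id).det := by
  -- Precomposing the summation variable with `σ` gives one expansion for each permutation; adding
  -- all of them up assembles the determinants of the minors of `A`.
  have key : ∀ σ : Equiv.Perm n, (A * B).det =
      ∑ f : n → m, ((Equiv.Perm.sign σ : ℤ) : R) * (∏ i, A i (f (σ i))) *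
        (B.submatrix f id).det := by
    intro σ
    rw [det_mul_eq_sum_prod_mul_det,
      ← Equiv.sum_comp (Equiv.arrowCongr σ.symm (Equiv.refl m))]
    refine Finset.sum_congr rfl fun f _ => ?_
    have : (B.submatrix (Equiv.arrowCongr σ.symm (Equiv.refl m) f) id) =
        (B.submatrix f id).submatrix σ id := by
      ext i j; simp
    rw [this, Matrix.det_permute]
    simp
    ring
  have h2 : ∑ σ : Equiv.Perm n, (A * B).det = ((Fintype.card n).factorial : R) * (A * B).det := by
    simp [Fintype.card_perm]
  rw [← h2, Finset.sum_congr rfl fun σ _ => key σ, Finset.sum_comm]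
  refine Finset.sum_congr rfl fun f _ => ?_
  rw [← Finset.sum_mul, ← Matrix.det_transpose (A.submatrix id f),
    Matrix.det_apply' (A.submatrix id f)ᵀ]
  rfl

/-! ### The oriented incidence matrix -/

/-- The oriented incidence matrix: the column of `e` is the indicator of the smaller end of `e`
minus the indicator of the larger one. It vanishes when `e` is a loop. -/
def incidence {N : ℕ} (e : Sym2 (Fin N)) (v : Fin N) : ℤ :=
  (if v = e.inf then 1 else 0) - (if v = e.sup then 1 else 0)

theorem mk_inf_sup {N : ℕ} (e : Sym2 (Fin N)) : s(e.inf, e.sup) = e := by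
  induction e with
  | _ a b =>
    rcases le_total a b with h | h
    · simp [h]
    · simp [h, Sym2.eq_swap]

theorem exists_incidence_mk {N : ℕ} (a b : Fin N) :
    ∃ ε : ℤ, ε * ε = 1 ∧ ∀ v, incidence s(a, b) v =
      ε * ((if v = a then 1 else 0) - (if v = b then 1 else 0)) := by
  rcases le_total a b with h | h
  · exact ⟨1, by simp, fun v => by simp [incidence, h]⟩
  · exact ⟨-1, by simp, fun v => by simp [incidence, h]⟩

theorem sum_mul_incidence {N : ℕ} (x : Fin N → ℤ) (e : Sym2 (Fin N)) :
    ∑ v, x v * incidence e v = x e.inf - x e.sup := by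
  simp [incidence, mul_sub, Finset.sum_sub_distrib]

/-- If `v` is reachable from `a`, the incidence columns span the difference `δ_v - δ_a` over `ℤ`:
add up the columns, with signs, along a path. -/
theorem exists_incidence_combination {N : ℕ} {m : Type*} [Fintype m] (f : m → Sym2 (Fin N))
    {a v : Fin N} (h : (SimpleGraph.fromEdgeSet (Set.range f)).Reachable a v) :
    ∃ c : m → ℤ, ∀ u, ∑ k, incidence (f k) u * c k =
      (if u = v then 1 else 0) - (if u = a then 1 else 0) := by
  classical
  obtain ⟨p⟩ := h
  induction p with
  | nil => exact ⟨0, by simp⟩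
  | cons hadj p ih =>
    rename_i x y z
    obtain ⟨c, hc⟩ := ih
    obtain ⟨⟨k, hk⟩, hne⟩ := hadj
    obtain ⟨ε, hε, hi⟩ := exists_incidence_mk x y
    refine ⟨c - Pi.single k ε, fun u => ?_⟩
    simp only [Pi.sub_apply, mul_sub, Finset.sum_sub_distrib, hc]
    have : ∑ j, incidence (f j) u * (Pi.single k ε : m → ℤ) j = incidence (f k) u * ε := by
      rw [Finset.sum_eq_single k]
      · simp
      · intro j _ hj
        simp [hj]
      · simp
    rw [this, hk, hi]
    linear_combination (-(if u = x then (1 : ℤ) else 0) + (if u = y then 1 else 0)) * hε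

/-- The square submatrix of the incidence matrix with the row of vertex `0` removed and columns
listed by `f`. -/
def incidenceMinor {D : ℕ} (f : Fin D → Sym2 (Fin (D + 1))) : Matrix (Fin D) (Fin D) ℤ :=
  Matrix.of fun i k => incidence (f k) i.succ

/-- The minor of a connected set of edges is `±1`, since it has an integral inverse. -/
theorem det_incidenceMinor_sq_of_connected {D : ℕ} (f : Fin D → Sym2 (Fin (D + 1)))
    (h : (SimpleGraph.fromEdgeSet (Set.range f)).Connected) :
    (incidenceMinor f).det ^ 2 = 1 := by
  choose c hc using fun v : Fin (D + 1) => exists_incidence_combination f (h.preconnected 0 v)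
  have hmul : incidenceMinor f * (Matrix.of fun k j => c (Fin.succ j) k) = 1 := by
    ext i j
    simp [Matrix.mul_apply, incidenceMinor, hc, Matrix.one_apply]
  have hu : IsUnit (incidenceMinor f).det :=
    IsUnit.of_mul_eq_one _ (by rw [← Matrix.det_mul, hmul, Matrix.det_one])
  rcases Int.isUnit_iff.1 hu with h | h <;> simp [h]

/-- The minor of a disconnected set of edges vanishes: the rows of a component that misses the
vertex `0` add up to zero. -/
theorem det_incidenceMinor_of_not_connected {D : ℕ} (f : Fin D → Sym2 (Fin (D + 1)))
    (h : ¬ (SimpleGraph.fromEdgeSet (Set.range f)).Connected) :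
    (incidenceMinor f).det = 0 := by
  classical
  obtain ⟨v, hv⟩ : ∃ v, ¬ (SimpleGraph.fromEdgeSet (Set.range f)).Reachable v 0 := by
    by_contra! hcon
    exact h ⟨fun a b => (hcon a).trans (hcon b).symm⟩
  let x : Fin (D + 1) → ℤ := fun u =>
    if (SimpleGraph.fromEdgeSet (Set.range f)).Reachable v u then 1 else 0
  have hx0 : x 0 = 0 := by simp [x, hv]
  rw [← Matrix.exists_vecMul_eq_zero_iff]
  refine ⟨fun i => x i.succ, fun h0 => ?_, ?_⟩
  · have hxv : x v = 1 := by simp [x]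
    rcases Fin.eq_zero_or_eq_succ v with rfl | ⟨j, rfl⟩
    · rw [hx0] at hxv; exact zero_ne_one hxv
    · have := congrFun h0 j
      simp only [Pi.zero_apply] at this
      omega
  · ext k
    have hs := sum_mul_incidence x (f k)
    rw [Fin.sum_univ_succ, hx0, zero_mul, zero_add] at hs
    have hval : x (f k).inf = x (f k).sup := by
      by_cases hne : (f k).inf = (f k).sup
      · rw [hne]
      · have hadj : (SimpleGraph.fromEdgeSet (Set.range f)).Adj (f k).inf (f k).sup :=
          ⟨⟨k, (mk_inf_sup _).symm⟩, hne⟩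
        have : (SimpleGraph.fromEdgeSet (Set.range f)).Reachable v (f k).inf ↔
            (SimpleGraph.fromEdgeSet (Set.range f)).Reachable v (f k).sup :=
          ⟨fun hr => hr.trans hadj.reachable, fun hr => hr.trans hadj.reachable.symm⟩
        simp only [x, this]
    simp only [Matrix.vecMul, dotProduct, incidenceMinor, Matrix.of_apply, Pi.zero_apply]
    rw [hs, hval, sub_self]

/-! ### The matrix tree theorem -/

/-- The link weights, extended by zero to all pairs of nodes. -/
noncomputable def edgeWeight {V : Type*} (G : SimpleGraph V) (w : Sym2 V → ℝ) (e : Sym2 V) : ℝ :=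
  open Classical in if e ∈ G.edgeSet then w e else 0

theorem laplacian_eq_sum {N : ℕ} (G : SimpleGraph (Fin N)) (w : Sym2 (Fin N) → ℝ)
    (i j : Fin N) :
    laplacian G w i j =
      ∑ e, edgeWeight G w e * (incidence e i : ℝ) * (incidence e j : ℝ) := by
  classical
  have hinc : ∀ a b v : Fin N, v ≠ a → v ≠ b → incidence s(a, b) v = 0 := by
    intro a b v ha hb
    obtain ⟨ε, -, h⟩ := exists_incidence_mk a b
    simp [h, ha, hb]
  by_cases hij : i = j
  · subst hij
    have h1 : laplacian G w i i = ∑ k, edgeWeight G w s(i, k) := by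
      simp [laplacian, edgeWeight]
    rw [h1]
    refine Finset.sum_of_injOn (fun k => s(i, k)) ?_ (by simp) ?_ ?_
    · intro a _ b _ hab
      exact Sym2.congr_right.1 hab
    · intro e _ he
      induction e with
      | _ a b =>
        rw [hinc a b i]
        · simp
        · rintro rfl
          exact he ⟨b, by simp⟩
        · rintro rfl
          exact he ⟨a, by simp [Sym2.eq_swap]⟩
    · intro k _
      by_cases hik : i = k
      · subst hik
        simp [edgeWeight]
      · obtain ⟨ε, hε, h⟩ := exists_incidence_mk i k
        have hε' : (ε : ℝ) * ε = 1 := by exact_mod_cast hε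
        simp only [h, if_neg hik, if_true]
        push_cast
        linear_combination (-edgeWeight G w s(i, k)) * hε'
  · rw [Finset.sum_eq_single s(i, j)]
    · obtain ⟨ε, hε, h⟩ := exists_incidence_mk i j
      have hε' : (ε : ℝ) * ε = 1 := by exact_mod_cast hε
      have h1 : laplacian G w i j = - edgeWeight G w s(i, j) := by
        simp [laplacian, edgeWeight, hij]
        split_ifs <;> simp
      simp only [h1, h, if_neg hij, if_neg (Ne.symm hij), if_true]
      push_cast
      linear_combination edgeWeight G w s(i, j) * hε'
    · intro e _ he
      induction e with
      | _ a b =>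
        by_cases hi : i = a ∨ i = b
        · by_cases hj : j = a ∨ j = b
          · exfalso
            apply he
            rcases hi with rfl | rfl <;> rcases hj with rfl | rfl
            · exact absurd rfl hij
            · rfl
            · exact Sym2.eq_swap
            · exact absurd rfl hij
          · push Not at hj
            simp [hinc a b j hj.1 hj.2]
        · push Not at hi
          simp [hinc a b i hi.1 hi.2]
    · simp

/-- The Laplacian with the row and the column of vertex `0` removed. -/
noncomputable def reducedLaplacian {D : ℕ} (G : SimpleGraph (Fin (D + 1)))
    (w : Sym2 (Fin (D + 1)) → ℝ) : Matrix (Fin D) (Fin D) ℝ :=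
  (laplacian G w).submatrix Fin.succ Fin.succ

theorem reducedLaplacian_eq_mul {D : ℕ} (G : SimpleGraph (Fin (D + 1)))
    (w : Sym2 (Fin (D + 1)) → ℝ) :
    reducedLaplacian G w =
      (Matrix.of fun (i : Fin D) e => (incidence e i.succ : ℝ)) *
        (Matrix.of fun e (j : Fin D) => edgeWeight G w e * (incidence e j.succ : ℝ)) := by
  ext i j
  simp only [reducedLaplacian, Matrix.submatrix_apply, laplacian_eq_sum, Matrix.mul_apply,
    Matrix.of_apply]
  exact Finset.sum_congr rfl fun e _ => by ring

/-- The column selections with a given image are the bijections onto it. -/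
theorem card_injective_image_eq {n m : Type*} [Fintype n] [DecidableEq n] [Fintype m]
    [DecidableEq m] (F : Finset m) (hF : F.card = Fintype.card n) :
    Nat.card {f : n → m // Function.Injective f ∧ Finset.univ.image f = F} =
      (Fintype.card n).factorial := by
  have e : {f : n → m // Function.Injective f ∧ Finset.univ.image f = F} ≃ (n ≃ F) :=
    { toFun := fun f => Equiv.ofBijective
        (fun i => ⟨f.1 i,
          (Finset.ext_iff.1 f.2.2 _).1 (Finset.mem_image_of_mem _ (Finset.mem_univ i))⟩)
        ⟨fun a b hab => f.2.1 (by simpa using hab), fun ⟨y, hy⟩ => by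
          rw [← f.2.2] at hy
          obtain ⟨i, -, hi⟩ := Finset.mem_image.1 hy
          exact ⟨i, Subtype.ext hi⟩⟩
      invFun := fun g => ⟨fun i => g i, fun a b hab => g.injective (Subtype.ext hab), by
        ext y
        simp only [Finset.mem_image, Finset.mem_univ, true_and]
        exact ⟨by rintro ⟨i, rfl⟩; exact (g i).2, fun hy => ⟨g.symm ⟨y, hy⟩, by simp⟩⟩⟩
      left_inv := fun f => by ext; rfl
      right_inv := fun g => by ext; rfl }
  have e0 : n ≃ F := Fintype.equivOfCardEq (by simp [hF])
  rw [Nat.card_congr e, Nat.card_eq_fintype_card, Fintype.card_equiv e0]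

theorem isTree_fromEdgeSet_iff {D : ℕ} {G : SimpleGraph (Fin (D + 1))}
    {F : Finset (Sym2 (Fin (D + 1)))} (hF : (F : Set (Sym2 (Fin (D + 1)))) ⊆ G.edgeSet) :
    (SimpleGraph.fromEdgeSet (F : Set (Sym2 (Fin (D + 1))))).IsTree ↔
      (SimpleGraph.fromEdgeSet (F : Set (Sym2 (Fin (D + 1))))).Connected ∧ F.card = D := by
  have h : (SimpleGraph.fromEdgeSet (F : Set (Sym2 (Fin (D + 1))))).edgeSet = F := by
    rw [SimpleGraph.edgeSet_fromEdgeSet, sdiff_eq_left, Set.disjoint_left]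
    exact fun e he hd => G.not_isDiag_of_mem_edgeSet (hF he) hd
  rw [SimpleGraph.isTree_iff_connected_and_card, h]
  simp

open Classical in
/-- The sum over trees as a sum over a filtered `Finset` of finite edge sets. In the elaborated
definition the summation variable is the underlying `Set` of such an edge set. -/
theorem spanningTreeWeight_eq_sum {V : Type*} [Fintype V] [DecidableEq V]
    (G : SimpleGraph V) (w : Sym2 V → ℝ) :
    spanningTreeWeight G w = ∑ F ∈ Finset.univ.filter fun F : Finset (Sym2 V) =>
      ((F : Set (Sym2 V)) ⊆ G.edgeSet ∧
        (SimpleGraph.fromEdgeSet (F : Set (Sym2 V))).IsTree), ∏ e ∈ F, w e := by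
  unfold spanningTreeWeight
  simp only [Finset.bind_def, Finset.pure_def]
  rw [Finset.sup_singleton_apply, Finset.filter_image, Finset.sum_image]
  · exact Finset.sum_congr rfl fun F _ => by
      congr 1
      ext e
      simp
  · exact fun a _ b _ h => Finset.coe_injective h

/-- The weighted matrix tree theorem. -/
theorem det_reducedLaplacian {D : ℕ} (G : SimpleGraph (Fin (D + 1)))
    (w : Sym2 (Fin (D + 1)) → ℝ) :
    (reducedLaplacian G w).det = spanningTreeWeight G w := by
  classical
  have hfact : ((Fintype.card (Fin D)).factorial : ℝ) ≠ 0 := by positivity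
  refine mul_left_cancel₀ hfact ?_
  rw [reducedLaplacian_eq_mul, factorial_mul_det_mul]
  set T : Finset (Finset (Sym2 (Fin (D + 1)))) := {F |
    (F : Set (Sym2 (Fin (D + 1)))) ⊆ G.edgeSet ∧
      (SimpleGraph.fromEdgeSet (F : Set (Sym2 (Fin (D + 1))))).IsTree} with hT
  have hterm : ∀ f : Fin D → Sym2 (Fin (D + 1)),
      ((Matrix.of fun (i : Fin D) e => (incidence e i.succ : ℝ)).submatrix id f).det *
        ((Matrix.of fun e (j : Fin D) =>
          edgeWeight G w e * (incidence e j.succ : ℝ)).submatrix f id).det =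
      if Function.Injective f ∧ Finset.univ.image f ∈ T then ∏ e ∈ Finset.univ.image f, w e
      else 0 := by
    intro f
    have h1 : ((Matrix.of fun (i : Fin D) e => (incidence e i.succ : ℝ)).submatrix id f).det =
        ((incidenceMinor f).det : ℝ) := by
      rw [Int.cast_det]
      rfl
    have h2 : ((Matrix.of fun e (j : Fin D) =>
          edgeWeight G w e * (incidence e j.succ : ℝ)).submatrix f id).det =
        (∏ i, edgeWeight G w (f i)) * ((incidenceMinor f).det : ℝ) := by
      rw [← h1, ← Matrix.det_transpose
        ((Matrix.of fun (i : Fin D) e => (incidence e i.succ : ℝ)).submatrix id f),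
        ← Matrix.det_mul_column]
      rfl
    rw [h1, h2, mul_left_comm, ← pow_two]
    by_cases hinj : Function.Injective f
    · rw [← Finset.prod_image (f := fun e => edgeWeight G w e) hinj.injOn]
      have hcard : (Finset.univ.image f).card = D := by
        rw [Finset.card_image_of_injective _ hinj]; simp
      have hcoe : ((Finset.univ.image f : Finset (Sym2 (Fin (D + 1)))) :
          Set (Sym2 (Fin (D + 1)))) = Set.range f := by simp
      by_cases hsub : ((Finset.univ.image f : Finset (Sym2 (Fin (D + 1)))) :
          Set (Sym2 (Fin (D + 1)))) ⊆ G.edgeSet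
      · have hw : ∏ e ∈ Finset.univ.image f, edgeWeight G w e =
            ∏ e ∈ Finset.univ.image f, w e :=
          Finset.prod_congr rfl fun e he => if_pos (hsub he)
        have htree := isTree_fromEdgeSet_iff hsub
        by_cases hcon : (SimpleGraph.fromEdgeSet (Set.range f)).Connected
        · rw [if_pos ⟨hinj, by
            rw [hT, Finset.mem_filter]
            exact ⟨Finset.mem_univ _, hsub, htree.2 ⟨by rwa [hcoe], hcard⟩⟩⟩, hw]
          have := det_incidenceMinor_sq_of_connected f hcon
          rw [show ((incidenceMinor f).det : ℝ) ^ 2 = 1 by exact_mod_cast this, mul_one]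
        · rw [if_neg, det_incidenceMinor_of_not_connected f hcon]
          · simp
          · rintro ⟨-, hm⟩
            rw [hT, Finset.mem_filter] at hm
            exact hcon (hcoe ▸ hm.2.2.1)
      · rw [if_neg]
        · obtain ⟨e, he, hne⟩ := Set.not_subset.1 hsub
          rw [Finset.prod_eq_zero he (if_neg hne), zero_mul]
        · rintro ⟨-, hm⟩
          rw [hT, Finset.mem_filter] at hm
          exact hsub hm.2.1
    · rw [if_neg fun h => hinj h.1]
      simp only [Function.Injective, not_forall] at hinj
      obtain ⟨a, b, hab, hne⟩ := hinj
      rw [Matrix.det_zero_of_column_eq hne (fun i => by simp [incidenceMinor, hab])]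
      simp
  rw [Finset.sum_congr rfl fun f _ => hterm f]
  have hsw : spanningTreeWeight G w = ∑ F ∈ T, ∏ e ∈ F, w e := by
    rw [spanningTreeWeight_eq_sum, hT]
  rw [hsw, Finset.mul_sum, ← Finset.sum_filter]
  rw [← Finset.sum_fiberwise_of_maps_to (g := fun f => Finset.univ.image f) (t := T)
    (fun f hf => (Finset.mem_filter.1 hf).2.2)]
  refine Finset.sum_congr rfl fun F hF => ?_
  have hFc : F.card = Fintype.card (Fin D) := by
    rw [hT, Finset.mem_filter] at hF
    rw [((isTree_fromEdgeSet_iff hF.2.1).1 hF.2.2).2, Fintype.card_fin]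
  rw [← card_injective_image_eq F hFc, Nat.card_eq_fintype_card, Fintype.card_subtype,
    Finset.filter_filter, Finset.card_eq_sum_ones, Nat.cast_sum, Finset.sum_mul]
  refine Finset.sum_congr ?_ fun f hf => ?_
  · ext f
    simp only [Finset.mem_filter, Finset.mem_univ, true_and]
    constructor
    · rintro ⟨⟨a, -⟩, c⟩; exact ⟨a, c⟩
    · rintro ⟨a, c⟩; exact ⟨⟨a, c ▸ hF⟩, c⟩
  · rw [(Finset.mem_filter.1 hf).2.2, Nat.cast_one, one_mul]

/-! ### Vertex systems -/

theorem edgeWeight_nonneg {V : Type*} {G : SimpleGraph V} {w : Sym2 V → ℝ}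
    (hw : ∀ e ∈ G.edgeSet, 0 < w e) (e : Sym2 V) : 0 ≤ edgeWeight G w e := by
  unfold edgeWeight
  split_ifs with h
  exacts [(hw e h).le, le_rfl]

theorem laplacian_symm {N : ℕ} (G : SimpleGraph (Fin N)) (w : Sym2 (Fin N) → ℝ)
    (i j : Fin N) : laplacian G w i j = laplacian G w j i := by
  simp only [laplacian_eq_sum]
  exact Finset.sum_congr rfl fun e _ => by ring

theorem sum_laplacian {N : ℕ} (G : SimpleGraph (Fin N)) (w : Sym2 (Fin N) → ℝ)
    (i : Fin N) : ∑ j, laplacian G w i j = 0 := by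
  simp only [laplacian_eq_sum]
  rw [Finset.sum_comm]
  refine Finset.sum_eq_zero fun e _ => ?_
  rw [← Finset.mul_sum]
  have h := sum_mul_incidence (fun _ => 1) e
  simp only [one_mul, sub_self] at h
  rw [← Int.cast_sum, h, Int.cast_zero, mul_zero]

theorem reducedLaplacian_posSemidef {D : ℕ} {G : SimpleGraph (Fin (D + 1))}
    {w : Sym2 (Fin (D + 1)) → ℝ} (hw : ∀ e ∈ G.edgeSet, 0 < w e) :
    (reducedLaplacian G w).PosSemidef := by
  have h : reducedLaplacian G w =
      (Matrix.of fun e (i : Fin D) => √(edgeWeight G w e) * (incidence e i.succ : ℝ))ᴴ *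
      (Matrix.of fun e (i : Fin D) => √(edgeWeight G w e) * (incidence e i.succ : ℝ)) := by
    ext i j
    simp only [reducedLaplacian, Matrix.submatrix_apply, laplacian_eq_sum, Matrix.mul_apply,
      Matrix.conjTranspose_apply, Matrix.of_apply, star_trivial]
    refine Finset.sum_congr rfl fun e _ => ?_
    linear_combination (-(incidence e i.succ : ℝ) * (incidence e j.succ : ℝ)) *
      Real.mul_self_sqrt (edgeWeight_nonneg hw e)
  rw [h]
  exact Matrix.posSemidef_conjTranspose_mul_self _

/-- The nonzero nodes carry the columns of a square root of the reduced Laplacian, and node `0` is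
placed so that the sum vanishes. -/
theorem exists_isVertexSystem {D : ℕ} {G : SimpleGraph (Fin (D + 1))}
    {w : Sym2 (Fin (D + 1)) → ℝ} (hw : ∀ e ∈ G.edgeSet, 0 < w e) :
    ∃ s : Fin (D + 1) → EuclideanSpace ℝ (Fin D), IsVertexSystem G w s := by
  obtain ⟨B, hB⟩ : ∃ B : Matrix (Fin D) (Fin D) ℝ, reducedLaplacian G w = Bᴴ * B := by
    open scoped MatrixOrder in
    exact CStarAlgebra.nonneg_iff_eq_star_mul_self.1
      (Matrix.nonneg_iff_posSemidef.2 (reducedLaplacian_posSemidef hw))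
  let t : Fin D → EuclideanSpace ℝ (Fin D) := fun i => WithLp.toLp 2 fun k => B k i
  have ht : ∀ i j, inner ℝ (t i) (t j) = laplacian G w i.succ j.succ := by
    intro i j
    have : laplacian G w i.succ j.succ = (Bᴴ * B) i j := by rw [← hB]; rfl
    rw [this, Matrix.mul_apply, PiLp.inner_apply]
    refine Finset.sum_congr rfl fun k _ => ?_
    simp [t, mul_comm]
  have hrow : ∀ i : Fin (D + 1), ∑ j : Fin D, laplacian G w i j.succ = -laplacian G w i 0 := by
    intro i
    have := sum_laplacian G w i
    rw [Fin.sum_univ_succ] at this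
    linarith
  have hcol : ∀ j : Fin (D + 1), ∑ i : Fin D, laplacian G w i.succ j = -laplacian G w 0 j := by
    intro j
    rw [laplacian_symm G w 0 j, ← hrow j]
    exact Finset.sum_congr rfl fun i _ => laplacian_symm ..
  refine ⟨Fin.cons (-∑ i, t i) t, fun i j => ?_⟩
  refine Fin.cases ?_ (fun i => ?_) i <;> refine Fin.cases ?_ (fun j => ?_) j
  · simp only [Fin.cons_zero, inner_neg_left, inner_neg_right, neg_neg, sum_inner, inner_sum, ht,
      hrow, hcol]
  · simp only [Fin.cons_zero, Fin.cons_succ, inner_neg_left, sum_inner, ht, hcol, neg_neg]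
  · simp only [Fin.cons_zero, Fin.cons_succ, inner_neg_right, inner_sum, ht, hrow, neg_neg]
  · simp only [Fin.cons_succ, ht]

theorem IsVertexSystem.sum_eq_zero {N D : ℕ} {G : SimpleGraph (Fin N)} {w : Sym2 (Fin N) → ℝ}
    {s : Fin N → EuclideanSpace ℝ (Fin D)} (hs : IsVertexSystem G w s) : ∑ i, s i = 0 := by
  rw [← inner_self_eq_zero (𝕜 := ℝ)]
  simp only [sum_inner, inner_sum, hs _ _]
  rw [Finset.sum_comm]
  simp only [sum_laplacian, Finset.sum_const_zero]

/-- The square matrix whose rows are the vertices other than `s 0`. -/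
def vertexMatrix {D : ℕ} (s : Fin (D + 1) → EuclideanSpace ℝ (Fin D)) :
    Matrix (Fin D) (Fin D) ℝ :=
  Matrix.of fun i k => s i.succ k

theorem IsVertexSystem.det_vertexMatrix_sq {D : ℕ} {G : SimpleGraph (Fin (D + 1))}
    {w : Sym2 (Fin (D + 1)) → ℝ} {s : Fin (D + 1) → EuclideanSpace ℝ (Fin D)}
    (hs : IsVertexSystem G w s) :
    (vertexMatrix s).det ^ 2 = spanningTreeWeight G w := by
  have h : vertexMatrix s * (vertexMatrix s)ᵀ = reducedLaplacian G w := by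
    ext i j
    rw [reducedLaplacian, Matrix.submatrix_apply, ← hs, Matrix.mul_apply, PiLp.inner_apply]
    exact Finset.sum_congr rfl fun k _ => by simp [vertexMatrix, mul_comm]
  rw [← det_reducedLaplacian, ← h, Matrix.det_mul, Matrix.det_transpose, pow_two]

theorem spanningTreeWeight_pos {V : Type*} [Fintype V] [DecidableEq V] {G : SimpleGraph V}
    (hG : G.Connected) {w : Sym2 V → ℝ} (hw : ∀ e ∈ G.edgeSet, 0 < w e) :
    0 < spanningTreeWeight G w := by
  classical
  rw [spanningTreeWeight_eq_sum]
  obtain ⟨T, hT, htree⟩ := hG.exists_isTree_le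
  refine Finset.sum_pos (fun F hF => Finset.prod_pos fun e he =>
    hw e ((Finset.mem_filter.1 hF).2.1 he)) ⟨T.edgeFinset, ?_⟩
  rw [Finset.mem_filter]
  refine ⟨Finset.mem_univ _, ?_, ?_⟩
  · simpa using hT
  · simpa using htree

/-- Two families with vanishing sums and linearly independent tails are related by a linear
equivalence. -/
theorem exists_linearEquiv_vertices {D : ℕ} {u s : Fin (D + 1) → EuclideanSpace ℝ (Fin D)}
    (hu : (vertexMatrix u).det ≠ 0) (hs : (vertexMatrix s).det ≠ 0) (hu0 : ∑ i, u i = 0)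
    (hs0 : ∑ i, s i = 0) :
    ∃ L : EuclideanSpace ℝ (Fin D) ≃ₗ[ℝ] EuclideanSpace ℝ (Fin D), ∀ i, L (u i) = s i := by
  have hbasis : ∀ v : Fin (D + 1) → EuclideanSpace ℝ (Fin D), (vertexMatrix v).det ≠ 0 →
      ∃ b : Module.Basis (Fin D) ℝ (EuclideanSpace ℝ (Fin D)), ∀ i, b i = v i.succ := by
    intro v hv
    have h1 : LinearIndependent ℝ (vertexMatrix v).row :=
      Matrix.linearIndependent_rows_of_det_ne_zero hv
    have h2 : LinearIndependent ℝ fun i : Fin D => v i.succ :=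
      h1.map' (WithLp.linearEquiv 2 ℝ (Fin D → ℝ)).symm.toLinearMap (LinearEquiv.ker _)
    exact ⟨basisOfLinearIndependentOfCardEqFinrank' _ h2 (by simp), fun i => by simp⟩
  obtain ⟨b, hb⟩ := hbasis u hu
  obtain ⟨c, hc⟩ := hbasis s hs
  have hsucc : ∀ i : Fin D, b.equiv c (Equiv.refl _) (u i.succ) = s i.succ := by
    intro i
    rw [← hb, Module.Basis.equiv_apply, ← hc, Equiv.refl_apply]
  refine ⟨b.equiv c (Equiv.refl _), fun i => ?_⟩
  refine Fin.cases ?_ hsucc i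
  rw [Fin.sum_univ_succ] at hu0 hs0
  rw [eq_neg_of_add_eq_zero_left hu0, eq_neg_of_add_eq_zero_left hs0, map_neg, map_sum]
  simp only [hsucc]

/-! ### The volume of a simplex -/

theorem measurableSet_cornerSimplex (n : ℕ) (t : ℝ) :
    MeasurableSet {x : Fin n → ℝ | (∀ i, 0 ≤ x i) ∧ ∑ i, x i ≤ t} := by
  refine IsClosed.measurableSet ?_
  simp only [Set.ofPred_and, Set.ofPred_forall]
  exact (isClosed_iInter fun i => isClosed_le (by fun_prop) (by fun_prop)).inter
    (isClosed_le (by fun_prop) (by fun_prop))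

/-- Fubini and induction on the dimension; the slice at first coordinate `x` is the corner simplex
of size `t - x`. -/
theorem volume_cornerSimplex (n : ℕ) (t : ℝ) (ht : 0 ≤ t) :
    volume {x : Fin n → ℝ | (∀ i, 0 ≤ x i) ∧ ∑ i, x i ≤ t} =
      ENNReal.ofReal (t ^ n / n.factorial) := by
  induction n generalizing t with
  | zero => simp [ht, volume_pi]
  | succ n ih =>
    have hmeas : MeasurableSet
        {p : ℝ × (Fin n → ℝ) | 0 ≤ p.1 ∧ (∀ i, 0 ≤ p.2 i) ∧ p.1 + ∑ i, p.2 i ≤ t} := by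
      refine IsClosed.measurableSet ?_
      simp only [Set.ofPred_and, Set.ofPred_forall]
      refine (isClosed_le (by fun_prop) (by fun_prop)).inter
        ((isClosed_iInter fun i => isClosed_le (by fun_prop) (by fun_prop)).inter
          (isClosed_le (by fun_prop) (by fun_prop)))
    have hpre : {x : Fin (n + 1) → ℝ | (∀ i, 0 ≤ x i) ∧ ∑ i, x i ≤ t} =
        (MeasurableEquiv.piFinSuccAbove (fun _ : Fin (n + 1) => ℝ) 0) ⁻¹'
          {p : ℝ × (Fin n → ℝ) | 0 ≤ p.1 ∧ (∀ i, 0 ≤ p.2 i) ∧ p.1 + ∑ i, p.2 i ≤ t} := by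
      ext x
      simp [Fin.forall_fin_succ, Fin.sum_univ_succ, MeasurableEquiv.piFinSuccAbove, Fin.tail,
        Fin.insertNthEquiv, and_assoc]
    rw [hpre, (volume_preserving_piFinSuccAbove (fun _ : Fin (n + 1) => ℝ) 0).measure_preimage
      hmeas.nullMeasurableSet, Measure.volume_eq_prod, Measure.prod_apply hmeas]
    have hslice : ∀ x : ℝ, volume (Prod.mk x ⁻¹'
        {p : ℝ × (Fin n → ℝ) | 0 ≤ p.1 ∧ (∀ i, 0 ≤ p.2 i) ∧ p.1 + ∑ i, p.2 i ≤ t}) =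
        (Set.Icc 0 t).indicator
          (fun x => ENNReal.ofReal ((t - x) ^ n / n.factorial)) x := by
      intro x
      by_cases hx : x ∈ Set.Icc 0 t
      · rw [Set.indicator_of_mem hx, ← ih (t - x) (by linarith [hx.2])]
        congr 1
        ext y
        simp [hx.1, le_sub_iff_add_le']
      · rw [Set.indicator_of_notMem hx]
        convert measure_empty (μ := (volume : Measure (Fin n → ℝ)))
        ext y
        simp only [Set.mem_preimage, Set.mem_ofPred_eq, Set.mem_empty_iff_false, iff_false]
        rintro ⟨h0, h1, h2⟩
        exact hx ⟨h0, by linarith [Finset.sum_nonneg fun i (_ : i ∈ Finset.univ) => h1 i]⟩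
    simp_rw [hslice]
    rw [lintegral_indicator measurableSet_Icc, ← ofReal_integral_eq_lintegral_ofReal]
    · rw [integral_Icc_eq_integral_Ioc, ← intervalIntegral.integral_of_le ht,
        intervalIntegral.integral_div, intervalIntegral.integral_comp_sub_left (fun x => x ^ n) t]
      simp only [sub_self, sub_zero, integral_pow]
      congr 1
      rw [Nat.factorial_succ]
      push_cast
      field_simp
      simp
    · exact Continuous.integrableOn_Icc (by fun_prop)
    · filter_upwards [ae_restrict_mem measurableSet_Icc] with x hx
      have : 0 ≤ t - x := by linarith [hx.2]
      positivity

/-- A simplex is a translated linear image of the corner simplex. -/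
theorem simplex_eq_image {D : ℕ} (s : Fin (D + 1) → EuclideanSpace ℝ (Fin D)) :
    simplex s = (fun x => s 0 + x) '' (Matrix.toEuclideanLin (Matrix.of fun k (i : Fin D) =>
      s i.succ k - s 0 k) '' (WithLp.ofLp ⁻¹' {x : Fin D → ℝ | (∀ i, 0 ≤ x i) ∧ ∑ i, x i ≤ 1})) := by
  have hval : ∀ x : EuclideanSpace ℝ (Fin D),
      s 0 + Matrix.toEuclideanLin (Matrix.of fun k (i : Fin D) => s i.succ k - s 0 k) x =
      (1 - ∑ i, x i) • s 0 + ∑ i, x i • s i.succ := by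
    intro x
    ext k
    simp only [PiLp.add_apply, PiLp.smul_apply, WithLp.ofLp_sum, Finset.sum_apply,
      WithLp.ofLp_smul, Pi.smul_apply, Matrix.toLpLin_apply, Matrix.mulVec, dotProduct,
      Matrix.of_apply, smul_eq_mul, sub_mul, Finset.sum_sub_distrib, Finset.sum_mul, one_mul]
    simp only [mul_comm]
    ring
  have hconv : Convex ℝ {x : Fin D → ℝ | (∀ i, 0 ≤ x i) ∧ ∑ i, x i ≤ 1} := by
    refine (convex_Ici (0 : Fin D → ℝ)).inter
      (convex_halfSpace_le (f := fun x : Fin D → ℝ => ∑ i, x i) ?_ 1)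
    exact ⟨fun x y => by simp [Finset.sum_add_distrib], fun c x => by simp [Finset.mul_sum]⟩
  refine subset_antisymm (convexHull_min ?_ ?_) ?_
  · rintro _ ⟨i, rfl⟩
    refine Fin.cases ?_ (fun i => ?_) i
    · refine ⟨_, ⟨0, by simp, rfl⟩, ?_⟩
      simp
    · refine ⟨_, ⟨WithLp.toLp 2 (Pi.single i 1), ⟨fun j => ?_, by simp⟩, rfl⟩, ?_⟩
      · have h : (0 : Fin D → ℝ) ≤ Pi.single i 1 := Pi.single_nonneg.2 zero_le_one
        exact h j
      · simp only [hval]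
        simp [Pi.single_apply]
  · exact ((hconv.linear_preimage
      (WithLp.linearEquiv 2 ℝ (Fin D → ℝ)).toLinearMap).linear_image _).translate (s 0)
  · rintro _ ⟨_, ⟨x, ⟨hx0, hx1⟩, rfl⟩, rfl⟩
    beta_reduce
    rw [hval]
    refine mem_convexHull_of_exists_fintype (Fin.cons (1 - ∑ i, x i) fun i => x i) s ?_ ?_
      (fun i => ⟨i, rfl⟩) ?_
    · intro i
      refine Fin.cases ?_ (fun i => ?_) i
      · simpa using hx1
      · simpa using hx0 i
    · simp [Fin.sum_univ_succ]
    · simp [Fin.sum_univ_succ]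

/-- For vertices with vanishing sum, the edge vectors issuing from `s 0` have
`D + 1` times the determinant of the remaining vertices. -/
theorem det_edgeMatrix {D : ℕ} {s : Fin (D + 1) → EuclideanSpace ℝ (Fin D)}
    (hs0 : ∑ i, s i = 0) :
    (Matrix.of fun k (i : Fin D) => s i.succ k - s 0 k).det =
      (D + 1) * (vertexMatrix s).det := by
  -- Since `s 0 = -∑ j, s j.succ`, the edge vectors are the rows of `(1 + J) * vertexMatrix s`.
  have h : (Matrix.of fun k (i : Fin D) => s i.succ k - s 0 k)ᵀ =
      (1 + Matrix.replicateCol Unit (fun _ : Fin D => (1 : ℝ)) *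
        Matrix.replicateRow Unit (fun _ : Fin D => (1 : ℝ))) * vertexMatrix s := by
    rw [Fin.sum_univ_succ] at hs0
    have h0 := eq_neg_of_add_eq_zero_left hs0
    ext i k
    rw [Matrix.add_mul, Matrix.one_mul, h0]
    simp [vertexMatrix, Matrix.mul_apply]
  rw [← Matrix.det_transpose, h, Matrix.det_mul, Matrix.det_one_add_replicateCol_mul_replicateRow]
  simp [dotProduct, add_comm]

theorem IsVertexSystem.volume_simplex {D : ℕ} {G : SimpleGraph (Fin (D + 1))}
    {w : Sym2 (Fin (D + 1)) → ℝ} {s : Fin (D + 1) → EuclideanSpace ℝ (Fin D)}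
    (hs : IsVertexSystem G w s) :
    volume.real (simplex s) = (D + 1) * √(spanningTreeWeight G w) / D.factorial := by
  have hfac : (0 : ℝ) ≤ 1 / (D.factorial : ℝ) := by positivity
  rw [Measure.real, simplex_eq_image, Set.image_add_left, measure_preimage_add,
    Measure.addHaar_image_linearMap,
    (PiLp.volume_preserving_ofLp (Fin D)).measure_preimage
      (measurableSet_cornerSimplex D 1).nullMeasurableSet,
    volume_cornerSimplex D 1 zero_le_one,
    show Matrix.toEuclideanLin (𝕜 := ℝ) (m := Fin D) (n := Fin D) = _ from
      Matrix.toLpLin_eq_toLin 2 2, LinearMap.det_toLin,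
    det_edgeMatrix hs.sum_eq_zero, ← hs.det_vertexMatrix_sq, Real.sqrt_sq_eq_abs, ENNReal.toReal_mul,
    ENNReal.toReal_ofReal (abs_nonneg _), one_pow, ENNReal.toReal_ofReal hfac, abs_mul,
    abs_of_nonneg (by positivity : (0 : ℝ) ≤ D + 1)]
  ring

/-! ### Volumes of ellipsoids -/

/-- The volume of the unit ball of `ℝ ^ D`. -/
noncomputable def unitBallVolume (D : ℕ) : ℝ :=
  √Real.pi ^ D / Real.Gamma ((D : ℝ) / 2 + 1)

theorem unitBallVolume_pos (D : ℕ) : 0 < unitBallVolume D := by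
  have := Real.Gamma_pos_of_pos (by positivity : (0 : ℝ) < (D : ℝ) / 2 + 1)
  have := Real.sqrt_pos.2 Real.pi_pos
  unfold unitBallVolume
  positivity

theorem enclosedVolume_image_sphere {D : ℕ} (hD : 0 < D)
    (f : EuclideanSpace ℝ (Fin D) ≃ᵃ[ℝ] EuclideanSpace ℝ (Fin D)) :
    enclosedVolume (f '' Metric.sphere 0 1) =
      |LinearMap.det (f.linear : EuclideanSpace ℝ (Fin D) →ₗ[ℝ] EuclideanSpace ℝ (Fin D))| *
        unitBallVolume D := by
  have : Nonempty (Fin D) := ⟨⟨0, hD⟩⟩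
  have himg : convexHull ℝ (f '' Metric.sphere 0 1) = (fun x => f 0 + x) ''
      ((f.linear : EuclideanSpace ℝ (Fin D) →ₗ[ℝ] EuclideanSpace ℝ (Fin D)) ''
        Metric.closedBall 0 1) := by
    rw [← convexHull_sphere_eq_closedBall (0 : EuclideanSpace ℝ (Fin D)) zero_le_one,
      Set.image_image]
    refine ((f : EuclideanSpace ℝ (Fin D) →ᵃ[ℝ] EuclideanSpace ℝ (Fin D)).image_convexHull
      _).symm.trans (Set.image_congr fun x _ => ?_)
    have := f.map_vadd 0 x
    simp only [vadd_eq_add, add_zero] at this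
    simpa [add_comm] using this
  rw [enclosedVolume, Measure.real, himg, Set.image_add_left, measure_preimage_add,
    Measure.addHaar_image_linearMap, EuclideanSpace.volume_closedBall, ENNReal.toReal_mul,
    ENNReal.toReal_ofReal (abs_nonneg _), ENNReal.ofReal_one, one_pow, one_mul, Fintype.card_fin]
  exact congrArg _ (ENNReal.toReal_ofReal (unitBallVolume_pos D).le)

/-! ### The determinant bound -/

/-- The arithmetic–geometric mean inequality for the eigenvalues, which follows from
`x ≤ exp (x - 1)` as their mean is `1`. -/
theorem det_le_one_of_trace {n : Type*} [Fintype n] [DecidableEq n] {A : Matrix n n ℝ}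
    (hA : A.PosSemidef) (htr : A.trace = Fintype.card n) : A.det ≤ 1 := by
  have hd : A.det = ∏ i, hA.1.eigenvalues i := by simpa using hA.1.det_eq_prod_eigenvalues
  have ht : A.trace = ∑ i, hA.1.eigenvalues i := by simpa using hA.1.trace_eq_sum_eigenvalues
  rw [hd]
  calc ∏ i, hA.1.eigenvalues i ≤ ∏ i, Real.exp (hA.1.eigenvalues i - 1) := by
        refine Finset.prod_le_prod (fun i _ => hA.eigenvalues_nonneg i) fun i _ => ?_
        simpa using Real.add_one_le_exp (hA.1.eigenvalues i - 1)
    _ = 1 := by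
        rw [← Real.exp_sum, Finset.sum_sub_distrib, ← ht, htr]
        simp

/-- The equality case of `det_le_one_of_trace`: the nonnegative numbers `x - 1 - log x`, for `x` an
eigenvalue, add up to zero, so every eigenvalue is `1`. -/
theorem eq_one_of_trace_of_det {n : Type*} [Fintype n] [DecidableEq n] {A : Matrix n n ℝ}
    (hA : A.PosSemidef) (htr : A.trace = Fintype.card n) (hdet : A.det = 1) : A = 1 := by
  have hd : A.det = ∏ i, hA.1.eigenvalues i := by simpa using hA.1.det_eq_prod_eigenvalues
  have ht : A.trace = ∑ i, hA.1.eigenvalues i := by simpa using hA.1.trace_eq_sum_eigenvalues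
  have hpos : ∀ i, 0 < hA.1.eigenvalues i := fun i => (hA.eigenvalues_nonneg i).lt_of_ne' fun h =>
    zero_ne_one (α := ℝ) (by rw [← hdet, hd, Finset.prod_eq_zero (Finset.mem_univ i) h])
  have hsum : ∑ i, (hA.1.eigenvalues i - 1 - Real.log (hA.1.eigenvalues i)) = 0 := by
    rw [Finset.sum_sub_distrib, Finset.sum_sub_distrib, ← ht, htr,
      ← Real.log_prod (fun i _ => (hpos i).ne'), ← hd, hdet]
    simp
  have hone : ∀ i, hA.1.eigenvalues i = 1 := by
    intro i
    have h0 := (Finset.sum_eq_zero_iff_of_nonneg fun i _ => by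
      linarith [Real.log_le_sub_one_of_pos (hpos i)]).1 hsum i (Finset.mem_univ i)
    by_contra hne
    linarith [Real.log_lt_sub_one_of_pos (hpos i) hne]
  have hspec := hA.1.spectral_theorem
  have hdiag : (Matrix.diagonal (RCLike.ofReal ∘ hA.1.eigenvalues) : Matrix n n ℝ) = 1 := by
    rw [← Matrix.diagonal_one]
    congr 1
    ext i
    simp [hone]
  rw [hspec, hdiag, map_one]

/-! ### Homogeneous coordinates -/

/-- Homogeneous coordinates of a point, with constant coordinate `a`. -/
def homog {D : ℕ} (a : ℝ) (x : EuclideanSpace ℝ (Fin D)) : Fin (D + 1) → ℝ :=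
  Fin.cons a x.ofLp

/-- The matrix whose rows are the homogeneous coordinates of the points `s i`. -/
def homogMatrix {D : ℕ} (a : ℝ) (s : Fin (D + 1) → EuclideanSpace ℝ (Fin D)) :
    Matrix (Fin (D + 1)) (Fin (D + 1)) ℝ :=
  Matrix.of fun i => homog a (s i)

theorem homog_dotProduct {D : ℕ} (a : ℝ) (x y : EuclideanSpace ℝ (Fin D)) :
    homog a x ⬝ᵥ homog a y = a ^ 2 + inner ℝ x y := by
  simp only [dotProduct, homog, Fin.sum_univ_succ, Fin.cons_zero, Fin.cons_succ, PiLp.inner_apply]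
  congr 1
  · ring
  · exact Finset.sum_congr rfl fun k _ => by simp [mul_comm]

theorem homogMatrix_mul_transpose {D : ℕ} (a : ℝ) (s : Fin (D + 1) → EuclideanSpace ℝ (Fin D))
    (i j : Fin (D + 1)) :
    (homogMatrix a s * (homogMatrix a s)ᵀ) i j = a ^ 2 + inner ℝ (s i) (s j) :=
  homog_dotProduct a (s i) (s j)

/-- An affine map acts on homogeneous coordinates by a block triangular matrix, whose determinant
is that of the linear part. -/
theorem exists_homog_matrix {D : ℕ} {a : ℝ} (ha : a ≠ 0)
    (f : EuclideanSpace ℝ (Fin D) ≃ᵃ[ℝ] EuclideanSpace ℝ (Fin D)) :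
    ∃ M : Matrix (Fin (D + 1)) (Fin (D + 1)) ℝ, (∀ x, homog a (f x) = homog a x ᵥ* M) ∧
      M.det = LinearMap.det
        (f.linear : EuclideanSpace ℝ (Fin D) →ₗ[ℝ] EuclideanSpace ℝ (Fin D)) := by
  let K : Matrix (Fin D) (Fin D) ℝ := LinearMap.toMatrix (EuclideanSpace.basisFun (Fin D) ℝ).toBasis
    (EuclideanSpace.basisFun (Fin D) ℝ).toBasis
    (f.linear : EuclideanSpace ℝ (Fin D) →ₗ[ℝ] EuclideanSpace ℝ (Fin D))
  have hK : ∀ x k, (f.linear x) k = ∑ i, x i * K k i := by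
    intro x k
    have h := LinearMap.toMatrix_mulVec_repr (EuclideanSpace.basisFun (Fin D) ℝ).toBasis
      (EuclideanSpace.basisFun (Fin D) ℝ).toBasis
      (f.linear : EuclideanSpace ℝ (Fin D) →ₗ[ℝ] EuclideanSpace ℝ (Fin D)) x
    have h' := congrFun h k
    simp only [Matrix.mulVec, dotProduct, OrthonormalBasis.coe_toBasis_repr_apply,
      EuclideanSpace.basisFun_repr] at h'
    refine h'.symm.trans (Finset.sum_congr rfl fun i _ => mul_comm _ _)
  refine ⟨Matrix.of (Fin.cons (Fin.cons 1 fun k => a⁻¹ * f 0 k) fun i => Fin.cons 0 fun k => K k i),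
    fun x => ?_, ?_⟩
  · have hx : f x = f.linear x + f 0 := by
      have := f.map_vadd 0 x
      simpa only [vadd_eq_add, add_zero] using this
    ext k
    refine Fin.cases ?_ (fun k => ?_) k
    · simp [homog, Matrix.vecMul, dotProduct, Fin.sum_univ_succ]
    · simp [homog, Matrix.vecMul, dotProduct, Fin.sum_univ_succ, hx, ha, add_comm, ← hK]
  · rw [Matrix.det_succ_column_zero, Fin.sum_univ_succ]
    have h : (Matrix.of (Fin.cons (Fin.cons 1 fun k => a⁻¹ * f 0 k) fun i =>
        Fin.cons 0 fun k => K k i : Fin (D + 1) → Fin (D + 1) → ℝ)).submatrix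
          (Fin.succAbove 0) Fin.succ = Kᵀ := by
      ext i j; simp
    rw [h, Matrix.det_transpose, LinearMap.det_toMatrix]
    simp

/-! ### Inscribed simplices of the unit sphere -/

/-- The Gram matrix of homogeneous coordinates, normalised to have unit diagonal for points of the
unit sphere. -/
noncomputable def normalizedGram {D : ℕ} (a : ℝ) (u : Fin (D + 1) → EuclideanSpace ℝ (Fin D)) :
    Matrix (Fin (D + 1)) (Fin (D + 1)) ℝ :=
  (1 + a ^ 2)⁻¹ • (homogMatrix a u * (homogMatrix a u)ᵀ)

theorem normalizedGram_posSemidef {D : ℕ} (a : ℝ)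
    (u : Fin (D + 1) → EuclideanSpace ℝ (Fin D)) : (normalizedGram a u).PosSemidef := by
  refine Matrix.PosSemidef.smul ?_ (by positivity)
  have := Matrix.posSemidef_self_mul_conjTranspose (homogMatrix a u)
  rwa [Matrix.conjTranspose_eq_transpose_of_trivial] at this

theorem trace_normalizedGram {D : ℕ} (a : ℝ) {u : Fin (D + 1) → EuclideanSpace ℝ (Fin D)}
    (hu : ∀ i, ‖u i‖ = 1) : (normalizedGram a u).trace = Fintype.card (Fin (D + 1)) := by
  have h : ∀ i, normalizedGram a u i i = 1 := by
    intro i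
    rw [normalizedGram, Matrix.smul_apply, homogMatrix_mul_transpose, real_inner_self_eq_norm_sq,
      hu, one_pow, smul_eq_mul, add_comm, inv_mul_cancel₀ (by positivity)]
  simp [Matrix.trace, h]

theorem det_normalizedGram {D : ℕ} (a : ℝ) (u : Fin (D + 1) → EuclideanSpace ℝ (Fin D)) :
    (normalizedGram a u).det = ((1 + a ^ 2)⁻¹) ^ (D + 1) * (homogMatrix a u).det ^ 2 := by
  rw [normalizedGram, Matrix.det_smul, Matrix.det_mul, Matrix.det_transpose, Fintype.card_fin,
    pow_two (homogMatrix a u).det]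

/-- If the homogeneous coordinates of the preimages of the vertices form an orthogonal frame, then
membership in the ellipsoid can be read off from the vertices alone. -/
theorem image_sphere_eq_of_normalizedGram_eq_one {D : ℕ} {a : ℝ} (ha : a ≠ 0)
    {s u : Fin (D + 1) → EuclideanSpace ℝ (Fin D)}
    (f : EuclideanSpace ℝ (Fin D) ≃ᵃ[ℝ] EuclideanSpace ℝ (Fin D)) (hf : ∀ i, f (u i) = s i)
    (hu : normalizedGram a u = 1) :
    f '' Metric.sphere 0 1 = {x | (homog a x ᵥ* (homogMatrix a s)⁻¹) ⬝ᵥ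
      (homog a x ᵥ* (homogMatrix a s)⁻¹) = 1} := by
  have hc : (1 + a ^ 2 : ℝ) ≠ 0 := by positivity
  obtain ⟨M, hM, hMdet⟩ := exists_homog_matrix ha f
  have hMu : IsUnit M.det := by
    rw [hMdet]
    exact (LinearEquiv.isUnit_det' f.linear)
  have hPs : homogMatrix a s = homogMatrix a u * M := by
    ext i j
    have := congrFun (hM (u i)) j
    rw [hf] at this
    exact this
  have hgram : homogMatrix a u * (homogMatrix a u)ᵀ = (1 + a ^ 2) • 1 := by
    rw [← hu, normalizedGram, smul_smul, mul_inv_cancel₀ hc, one_smul]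
  have hPu : IsUnit (homogMatrix a u).det := by
    rw [isUnit_iff_ne_zero]
    intro h0
    have := det_normalizedGram a u
    rw [hu, h0, Matrix.det_one] at this
    simp at this
  have hPsu : IsUnit (homogMatrix a s).det := by
    rw [hPs, Matrix.det_mul]; exact hPu.mul hMu
  -- Up to the factor `1 + a ^ 2`, the squared norm of the homogeneous coordinates of a point `y`
  -- is that of the barycentric coordinates of `f y`, since `homogMatrix a u` is a scaled isometry.
  have key : ∀ y, a ^ 2 + ‖y‖ ^ 2 = (1 + a ^ 2) *
      ((homog a (f y) ᵥ* (homogMatrix a s)⁻¹) ⬝ᵥ (homog a (f y) ᵥ* (homogMatrix a s)⁻¹)) := by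
    intro y
    set c := homog a (f y) ᵥ* (homogMatrix a s)⁻¹ with hcdef
    have h1 : c ᵥ* homogMatrix a u = homog a y := by
      have h2 : c ᵥ* homogMatrix a s = homog a (f y) := by
        rw [hcdef, Matrix.vecMul_vecMul, Matrix.nonsing_inv_mul _ hPsu, Matrix.vecMul_one]
      rw [hPs, ← Matrix.vecMul_vecMul, hM] at h2
      exact Matrix.vecMul_injective_of_isUnit ((Matrix.isUnit_iff_isUnit_det _).2 hMu) h2
    rw [← real_inner_self_eq_norm_sq, ← homog_dotProduct, ← h1, ← Matrix.mulVec_transpose,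
      Matrix.dotProduct_mulVec, Matrix.mulVec_transpose, Matrix.vecMul_vecMul, hgram]
    rw [Matrix.vecMul_smul, Matrix.vecMul_one, smul_dotProduct, smul_eq_mul]
  ext x
  obtain ⟨y, rfl⟩ := f.surjective x
  have hy := key y
  rw [f.injective.mem_set_image, mem_sphere_zero_iff_norm, Set.mem_ofPred_eq]
  constructor
  · intro h
    rw [h] at hy
    have : (1 + a ^ 2) * ((homog a (f y) ᵥ* (homogMatrix a s)⁻¹) ⬝ᵥ
        (homog a (f y) ᵥ* (homogMatrix a s)⁻¹)) = (1 + a ^ 2) * 1 := by linarith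
    exact mul_left_cancel₀ hc this
  · intro h
    rw [h] at hy
    have : ‖y‖ ^ 2 = 1 := by linarith
    exact (pow_eq_one_iff_of_nonneg (norm_nonneg y) two_ne_zero).1 this

/-- The regular simplex inscribed in the unit sphere, as a vertex system of the complete graph. -/
theorem exists_regular_vertices {D : ℕ} (hD : 0 < D) :
    ∃ u : Fin (D + 1) → EuclideanSpace ℝ (Fin D), (∀ i, ‖u i‖ = 1) ∧ ∑ i, u i = 0 ∧
      ∀ i j, i ≠ j → inner ℝ (u i) (u j) = -(1 / D : ℝ) := by
  have hD' : (0 : ℝ) < D := by exact_mod_cast hD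
  obtain ⟨u, hu⟩ := exists_isVertexSystem (D := D) (G := ⊤) (w := fun _ => (1 / D : ℝ))
    (fun _ _ => by positivity)
  refine ⟨u, fun i => ?_, hu.sum_eq_zero, fun i j hij => ?_⟩
  · have h := hu i i
    have h1 : laplacian ⊤ (fun _ => (1 / D : ℝ)) i i = 1 := by
      have h2 := sum_laplacian (⊤ : SimpleGraph (Fin (D + 1))) (fun _ => (1 / D : ℝ)) i
      rw [← Finset.add_sum_erase _ _ (Finset.mem_univ i),
        Finset.sum_congr rfl (g := fun _ => -(1 / D : ℝ)) fun j hj => by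
          simp [laplacian, (Finset.ne_of_mem_erase hj).symm]] at h2
      simp only [Finset.sum_const, Finset.card_erase_of_mem (Finset.mem_univ i), Finset.card_univ,
        Fintype.card_fin, Nat.add_sub_cancel, nsmul_eq_mul] at h2
      have h3 : (D : ℝ) * -(1 / D) = -1 := by field_simp
      rw [h3] at h2
      linarith
    rw [h1, real_inner_self_eq_norm_sq] at h
    exact (pow_eq_one_iff_of_nonneg (norm_nonneg _) two_ne_zero).1 h
  · rw [hu]
    simp [laplacian, hij]

theorem normalizedGram_regular {D : ℕ} (hD : 0 < D) {u : Fin (D + 1) → EuclideanSpace ℝ (Fin D)}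
    (h1 : ∀ i, ‖u i‖ = 1) (h2 : ∀ i j, i ≠ j → inner ℝ (u i) (u j) = -(1 / D : ℝ)) :
    normalizedGram (√(1 / D)) u = 1 := by
  have hsq : √(1 / D : ℝ) ^ 2 = 1 / D := Real.sq_sqrt (by positivity)
  ext i j
  rw [normalizedGram, Matrix.smul_apply, homogMatrix_mul_transpose, hsq]
  by_cases hij : i = j
  · subst hij
    rw [real_inner_self_eq_norm_sq, h1, Matrix.one_apply_eq, smul_eq_mul, one_pow, add_comm,
      inv_mul_cancel₀ (by positivity)]
  · rw [h2 i j hij, Matrix.one_apply_ne hij]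
    simp

theorem det_vertexMatrix_regular_sq {D : ℕ} (hD : 0 < D)
    {u : Fin (D + 1) → EuclideanSpace ℝ (Fin D)}
    (h1 : ∀ i, ‖u i‖ = 1) (h2 : ∀ i j, i ≠ j → inner ℝ (u i) (u j) = -(1 / D : ℝ)) :
    (vertexMatrix u).det ^ 2 = ((D + 1 : ℝ) / D) ^ D / (D + 1) := by
  have hD' : (D : ℝ) ≠ 0 := by positivity
  -- The Gram matrix is a scalar matrix plus a rank one perturbation.
  have h : vertexMatrix u * (vertexMatrix u)ᵀ = ((D + 1 : ℝ) / D) •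
      (1 + Matrix.replicateCol Unit (fun _ : Fin D => (-(1 / (D + 1)) : ℝ)) *
        Matrix.replicateRow Unit (fun _ : Fin D => (1 : ℝ))) := by
    ext i j
    have hin : (vertexMatrix u * (vertexMatrix u)ᵀ) i j = inner ℝ (u i.succ) (u j.succ) := by
      rw [Matrix.mul_apply, PiLp.inner_apply]
      exact Finset.sum_congr rfl fun k _ => by simp [vertexMatrix, mul_comm]
    rw [hin]
    simp only [Matrix.smul_apply, Matrix.add_apply, Matrix.mul_apply, Matrix.replicateCol_apply,
      Matrix.replicateRow_apply, Finset.univ_unique, Finset.sum_singleton, smul_eq_mul]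
    by_cases hij : i = j
    · subst hij
      rw [real_inner_self_eq_norm_sq, h1, Matrix.one_apply_eq]
      field_simp
      ring
    · rw [h2 _ _ (by simpa using hij), Matrix.one_apply_ne hij]
      field_simp
      ring
  have := congrArg Matrix.det h
  rw [Matrix.det_mul, Matrix.det_transpose, ← pow_two, Matrix.det_smul, Fintype.card_fin,
    Matrix.det_one_add_replicateCol_mul_replicateRow] at this
  rw [this]
  have hdot : (fun _ : Fin D => (1 : ℝ)) ⬝ᵥ (fun _ : Fin D => (-(1 / (D + 1)) : ℝ)) =
      -(D / (D + 1)) := by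
    simp [dotProduct]
    ring
  rw [hdot]
  field_simp
  ring

/-! ### The Steiner ellipsoid -/

/-- Existence, uniqueness and volume of the Steiner ellipsoid of a nondegenerate simplex with
centroid `0`. -/
theorem exists_steinerEllipsoid {D : ℕ} (hD : 0 < D)
    {s : Fin (D + 1) → EuclideanSpace ℝ (Fin D)} (hs : (vertexMatrix s).det ≠ 0)
    (hs0 : ∑ i, s i = 0) :
    ∃ E, IsSteinerEllipsoid s E ∧ (∀ E', IsSteinerEllipsoid s E' → E' = E) ∧
      enclosedVolume E = √((D + 1) * (D / (D + 1)) ^ D * (vertexMatrix s).det ^ 2) *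
        unitBallVolume D := by
  have hD' : (0 : ℝ) < D := by exact_mod_cast hD
  obtain ⟨u, hu1, hu0, hu2⟩ := exists_regular_vertices hD
  have hudet := det_vertexMatrix_regular_sq hD hu1 hu2
  have hune : (vertexMatrix u).det ≠ 0 := by
    intro h0
    rw [h0] at hudet
    have : (0 : ℝ) < ((D + 1 : ℝ) / D) ^ D / (D + 1) := by positivity
    rw [← hudet] at this
    simp at this
  obtain ⟨L, hL⟩ := exists_linearEquiv_vertices hune hs hu0 hs0
  -- This constant coordinate makes the homogeneous coordinates of the regular simplex orthogonal.
  set a : ℝ := √(1 / D) with ha_def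
  have ha : a ≠ 0 := (Real.sqrt_pos.2 (by positivity)).ne'
  have hgram := normalizedGram_regular hD hu1 hu2
  rw [← ha_def] at hgram
  -- The determinant of the homogeneous coordinates splits off the linear part.
  have hsplit : ∀ (f : EuclideanSpace ℝ (Fin D) ≃ᵃ[ℝ] EuclideanSpace ℝ (Fin D))
      (v : Fin (D + 1) → EuclideanSpace ℝ (Fin D)), (∀ i, f (v i) = s i) →
      (normalizedGram a s).det = (normalizedGram a v).det * LinearMap.det
        (f.linear : EuclideanSpace ℝ (Fin D) →ₗ[ℝ] EuclideanSpace ℝ (Fin D)) ^ 2 := by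
    intro f v hf
    obtain ⟨M, hM, hMdet⟩ := exists_homog_matrix ha f
    have hP : homogMatrix a s = homogMatrix a v * M := by
      ext i j
      have := congrFun (hM (v i)) j
      rw [hf] at this
      exact this
    rw [det_normalizedGram, det_normalizedGram, hP, Matrix.det_mul, hMdet]
    ring
  set f₀ := L.toAffineEquiv with hf₀
  have hf₀s : ∀ i, f₀ (u i) = s i := hL
  have hdet₀ := hsplit f₀ u hf₀s
  rw [hgram, Matrix.det_one, one_mul] at hdet₀
  have hunit : ∀ (f : EuclideanSpace ℝ (Fin D) ≃ᵃ[ℝ] EuclideanSpace ℝ (Fin D)),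
      (∀ i, s i ∈ f '' Metric.sphere 0 1) → ∃ v : Fin (D + 1) → EuclideanSpace ℝ (Fin D),
        (∀ i, f (v i) = s i) ∧ ∀ i, ‖v i‖ = 1 := by
    intro f hf
    choose v hv1 hv2 using hf
    exact ⟨v, hv2, fun i => mem_sphere_zero_iff_norm.1 (hv1 i)⟩
  have hκ := unitBallVolume_pos D
  have hsteiner : IsSteinerEllipsoid s (f₀ '' Metric.sphere 0 1) := by
    refine ⟨⟨⟨f₀, rfl⟩, fun i => ⟨u i, mem_sphere_zero_iff_norm.2 (hu1 i), hf₀s i⟩⟩, ?_⟩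
    rintro _ ⟨⟨f, rfl⟩, hf⟩
    obtain ⟨v, hv, hv1⟩ := hunit f hf
    rw [enclosedVolume_image_sphere hD, enclosedVolume_image_sphere hD]
    refine mul_le_mul_of_nonneg_right (sq_le_sq.1 ?_) hκ.le
    rw [← hdet₀, hsplit f v hv]
    exact mul_le_of_le_one_left (sq_nonneg _)
      (det_le_one_of_trace (normalizedGram_posSemidef a v) (trace_normalizedGram a hv1))
  refine ⟨f₀ '' Metric.sphere 0 1, hsteiner, ?_, ?_⟩
  · rintro _ ⟨⟨⟨f, rfl⟩, hf⟩, hmin⟩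
    obtain ⟨v, hv, hv1⟩ := hunit f hf
    have hvol := le_antisymm (hmin _ hsteiner.1) (hsteiner.2 _ ⟨⟨f, rfl⟩, hf⟩)
    rw [enclosedVolume_image_sphere hD, enclosedVolume_image_sphere hD] at hvol
    have hdet := (sq_eq_sq_iff_abs_eq_abs _ _).2 (mul_right_cancel₀ hκ.ne' hvol)
    have hne : LinearMap.det
        (f.linear : EuclideanSpace ℝ (Fin D) →ₗ[ℝ] EuclideanSpace ℝ (Fin D)) ^ 2 ≠ 0 :=
      pow_ne_zero 2 (LinearEquiv.isUnit_det' f.linear).ne_zero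
    have hone : (normalizedGram a v).det = 1 := by
      have := hsplit f v hv
      rw [hdet₀, ← hdet] at this
      exact (mul_left_injective₀ hne (by simpa using this)).symm
    have hv_gram := eq_one_of_trace_of_det (normalizedGram_posSemidef a v)
      (trace_normalizedGram a hv1) hone
    rw [image_sphere_eq_of_normalizedGram_eq_one ha f hv hv_gram,
      image_sphere_eq_of_normalizedGram_eq_one ha f₀ hf₀s hgram]
  · rw [enclosedVolume_image_sphere hD, ← Real.sqrt_sq_eq_abs]
    congr 2
    have hmat : vertexMatrix s = vertexMatrix u * (LinearMap.toMatrix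
        (EuclideanSpace.basisFun (Fin D) ℝ).toBasis (EuclideanSpace.basisFun (Fin D) ℝ).toBasis
        (L : EuclideanSpace ℝ (Fin D) →ₗ[ℝ] EuclideanSpace ℝ (Fin D)))ᵀ := by
      ext i k
      have h := congrFun (LinearMap.toMatrix_mulVec_repr
        (EuclideanSpace.basisFun (Fin D) ℝ).toBasis (EuclideanSpace.basisFun (Fin D) ℝ).toBasis
        (L : EuclideanSpace ℝ (Fin D) →ₗ[ℝ] EuclideanSpace ℝ (Fin D)) (u i.succ)) k
      simp only [Matrix.mulVec, dotProduct, OrthonormalBasis.coe_toBasis_repr_apply,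
        EuclideanSpace.basisFun_repr, LinearEquiv.coe_coe, hL] at h
      rw [vertexMatrix, Matrix.of_apply, ← h, Matrix.mul_apply]
      exact Finset.sum_congr rfl fun j _ => mul_comm _ _
    rw [hmat, Matrix.det_mul, Matrix.det_transpose, LinearMap.det_toMatrix, mul_pow, hudet]
    have : ((D : ℝ) / (D + 1)) ^ D * ((D + 1 : ℝ) / D) ^ D = 1 := by
      rw [← mul_pow]
      have : ((D : ℝ) / (D + 1)) * ((D + 1 : ℝ) / D) = 1 := by field_simp
      rw [this, one_pow]
    have hlin : (f₀.linear : EuclideanSpace ℝ (Fin D) →ₗ[ℝ] EuclideanSpace ℝ (Fin D)) = L := rfl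
    rw [hlin]
    generalize ((D : ℝ) / (D + 1)) ^ D = p at this ⊢
    generalize ((D + 1 : ℝ) / D) ^ D = q at this ⊢
    field_simp
    rw [mul_comm p q] at this
    linear_combination (-(LinearMap.det
      (L : EuclideanSpace ℝ (Fin D) →ₗ[ℝ] EuclideanSpace ℝ (Fin D))) ^ 2) * this

/-! ### Evaluation of the Gamma factors -/

theorem rpow_natCast_div_two {x : ℝ} (hx : 0 ≤ x) (n : ℕ) : x ^ ((n : ℝ) / 2) = √x ^ n := by
  rw [Real.sqrt_eq_rpow, ← Real.rpow_mul_natCast hx]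
  congr 1
  ring

theorem sqrt_pow_eq_pow_sqrt {x : ℝ} (hx : 0 ≤ x) (n : ℕ) : √(x ^ n) = √x ^ n := by
  rw [Real.sqrt_eq_iff_eq_sq (by positivity) (by positivity), ← pow_mul, mul_comm n 2, pow_mul,
    Real.sq_sqrt hx]

theorem ellipsoid_volume_formula (D : ℕ) (ξ : ℝ) :
    √((D + 1) * (D / (D + 1)) ^ D * ξ) * unitBallVolume D =
      ((D : ℝ) * Real.pi / (D + 1)) ^ ((D : ℝ) / 2) *
        (√((D + 1) * ξ) / Real.Gamma ((D + 1 + 1 : ℝ) / 2)) := by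
  rw [rpow_natCast_div_two (by positivity), unitBallVolume,
    show (D : ℝ) / 2 + 1 = (D + 1 + 1) / 2 by ring, mul_right_comm, mul_comm (_ * ξ),
    Real.sqrt_mul (by positivity), sqrt_pow_eq_pow_sqrt (by positivity),
    show (D : ℝ) * Real.pi / (D + 1) = D / (D + 1) * Real.pi by ring,
    Real.sqrt_mul (by positivity) Real.pi, mul_pow]
  ring

theorem ratio_formula {D : ℕ} {ξ : ℝ} (hξ : 0 < ξ) :
    ((D : ℝ) * Real.pi / (D + 1)) ^ ((D : ℝ) / 2) *
        (√((D + 1) * ξ) / Real.Gamma ((D + 1 + 1 : ℝ) / 2)) /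
        ((D + 1) * √ξ / Real.Gamma (D + 1)) =
      ((D : ℝ) * Real.pi) ^ ((D : ℝ) / 2) / (D + 1 : ℝ) ^ ((D + 1 : ℝ) / 2) *
        (Real.Gamma (D + 1) / Real.Gamma ((D + 1 + 1 : ℝ) / 2)) := by
  have hN := rpow_natCast_div_two (by positivity : (0 : ℝ) ≤ D + 1) (D + 1)
  push_cast at hN
  rw [hN, rpow_natCast_div_two (by positivity), rpow_natCast_div_two (by positivity),
    Real.sqrt_div (by positivity), Real.sqrt_mul (by positivity) ξ]
  have h1 : 0 < √ξ := Real.sqrt_pos.2 hξ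
  have h2 : 0 < √(D + 1 : ℝ) := Real.sqrt_pos.2 (by positivity)
  have h3 : √(D + 1 : ℝ) ^ 2 = D + 1 := Real.sq_sqrt (by positivity)
  have h4 := Real.Gamma_pos_of_pos (by positivity : (0 : ℝ) < D + 1)
  have h5 := Real.Gamma_pos_of_pos (by positivity : (0 : ℝ) < (D + 1 + 1) / 2)
  generalize √((D : ℝ) * Real.pi) = x
  generalize √(D + 1 : ℝ) = r at *
  rw [← h3] at h4 h5 ⊢
  rw [div_pow]
  field_simp
  ring

/-- Legendre's duplication formula at `(D + 1) / 2` turns one form of the ratio into the other. -/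
theorem ratio_formula_duplication {D : ℕ} (hD : 0 < D) :
    ((D : ℝ) * Real.pi) ^ ((D : ℝ) / 2) / (D + 1 : ℝ) ^ ((D + 1 : ℝ) / 2) *
        (Real.Gamma (D + 1) / Real.Gamma ((D + 1 + 1 : ℝ) / 2)) =
      ((D : ℝ) / (D + 1)) ^ ((D + 1 : ℝ) / 2) *
        ((2 * √Real.pi) ^ (D + 1) / (2 * Real.pi)) *
        (Real.Gamma ((D + 1 : ℝ) / 2) / √D) := by
  have hD' : (0 : ℝ) < D := by exact_mod_cast hD
  have hN : ∀ x : ℝ, 0 ≤ x → x ^ ((D + 1 : ℝ) / 2) = √x ^ (D + 1) := by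
    intro x hx
    rw [← rpow_natCast_div_two hx]
    push_cast
    rfl
  have hdup := Real.Gamma_mul_Gamma_add_half ((D + 1 : ℝ) / 2)
  rw [show (D + 1 : ℝ) / 2 + 1 / 2 = (D + 1 + 1) / 2 by ring,
    show 2 * ((D + 1 : ℝ) / 2) = D + 1 by ring, show 1 - (D + 1 : ℝ) = -D by ring,
    Real.rpow_neg (by norm_num), Real.rpow_natCast] at hdup
  rw [hN _ (by positivity), hN _ (by positivity), rpow_natCast_div_two (by positivity),
    Real.sqrt_mul hD'.le, Real.sqrt_div hD'.le]
  have h1 : 0 < √(D : ℝ) := Real.sqrt_pos.2 hD'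
  have h2 : 0 < √(D + 1 : ℝ) := Real.sqrt_pos.2 (by positivity)
  have h3 : √Real.pi ^ 2 = Real.pi := Real.sq_sqrt Real.pi_pos.le
  have h6 : 0 < √Real.pi := Real.sqrt_pos.2 Real.pi_pos
  have h5 := Real.Gamma_pos_of_pos (by positivity : (0 : ℝ) < (D + 1 + 1) / 2)
  generalize Real.Gamma ((D + 1 + 1 : ℝ) / 2) = g at *
  generalize Real.Gamma (D + 1 : ℝ) = g₁ at *
  generalize Real.Gamma ((D + 1 : ℝ) / 2) = g₂ at *
  have hg : g₁ = g₂ * g * 2 ^ D / √Real.pi := by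
    rw [hdup]
    field_simp
  rw [hg]
  nth_rewrite 4 [← h3]
  rw [div_pow]
  field_simp
  ring


end GraphSimplex

theorem mainTheorem7 (N : ℕ) (hN : 2 ≤ N) (G : SimpleGraph (Fin N)) (hG : G.Connected)
    (w : Sym2 (Fin N) → ℝ) (hw : ∀ e ∈ G.edgeSet, 0 < w e) :
    (∃ s : Fin N → EuclideanSpace ℝ (Fin (N - 1)), GraphSimplex.IsVertexSystem G w s) ∧
    ∀ s : Fin N → EuclideanSpace ℝ (Fin (N - 1)), GraphSimplex.IsVertexSystem G w s →
      (∃! E, GraphSimplex.IsSteinerEllipsoid s E) ∧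
      MeasureTheory.volume.real (GraphSimplex.simplex s) =
        N * √(GraphSimplex.spanningTreeWeight G w) / Real.Gamma N ∧
      ∀ E, GraphSimplex.IsSteinerEllipsoid s E →
        GraphSimplex.enclosedVolume E =
          (((N : ℝ) - 1) * Real.pi / N) ^ (((N : ℝ) - 1) / 2) *
            (√(N * GraphSimplex.spanningTreeWeight G w) / Real.Gamma (((N : ℝ) + 1) / 2)) ∧
        GraphSimplex.enclosedVolume E / MeasureTheory.volume.real (GraphSimplex.simplex s) =
          (((N : ℝ) - 1) * Real.pi) ^ (((N : ℝ) - 1) / 2) / (N : ℝ) ^ ((N : ℝ) / 2) *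
            (Real.Gamma N / Real.Gamma (((N : ℝ) + 1) / 2)) ∧
        GraphSimplex.enclosedVolume E / MeasureTheory.volume.real (GraphSimplex.simplex s) =
          (((N : ℝ) - 1) / N) ^ ((N : ℝ) / 2) * ((2 * √Real.pi) ^ N / (2 * Real.pi)) *
            (Real.Gamma ((N : ℝ) / 2) / √((N : ℝ) - 1)) := by
  open GraphSimplex in
  obtain ⟨D, rfl⟩ : ∃ D, N = D + 1 := ⟨N - 1, by omega⟩
  have hD : 0 < D := by omega
  rw [Nat.add_sub_cancel]
  refine ⟨exists_isVertexSystem hw, fun s hs => ?_⟩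
  have hξ := spanningTreeWeight_pos hG hw
  have hdet := hs.det_vertexMatrix_sq
  have hne : (vertexMatrix s).det ≠ 0 := by
    intro h0
    rw [h0] at hdet
    simp only [ne_eq, OfNat.ofNat_ne_zero, not_false_eq_true, zero_pow] at hdet
    exact hξ.ne hdet
  have hvol : volume.real (simplex s) =
      (D + 1) * √(spanningTreeWeight G w) / Real.Gamma (D + 1) := by
    rw [hs.volume_simplex, Real.Gamma_nat_eq_factorial]
  obtain ⟨E₀, hE₀, huniq, hE₀vol⟩ := exists_steinerEllipsoid hD hne hs.sum_eq_zero
  rw [hdet, ellipsoid_volume_formula] at hE₀vol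
  push_cast
  simp only [add_sub_cancel_right]
  refine ⟨⟨E₀, hE₀, huniq⟩, hvol, fun E hE => ?_⟩
  rw [huniq E hE, hE₀vol, hvol, ratio_formula hξ]
  exact ⟨rfl, rfl, ratio_formula_duplication hD⟩
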